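/- \emph{Vocabulary and logic.} Let $\mathbb R_\bot=\mathbb R\cup\{\bot\}$. For $m\ge 1$, let $\Upsilon^{\mathrm{net}}(m,1)$ be the vocabulary with a binary relation symbol $E$, constant symbols $\mathrm{in}_1,\dots,\mathrm{in}_m$ and $\mathrm{out}_1$, a unary weight function symbol $b$ and a binary weight function symbol $w$; in finite structures, weight function symbols are interpreted by functions with values in $\mathbb R_\bot$. Formulas of $\mathrm{FO(SUM)}$ are built as in first-order logic (with equality), with variables ranging over the domain of the structure, from the usual atomic formulas and the additional atomic formulas $t_1=t_2$ and $t_1<t_2$ for weight terms $t_1,t_2$. Weight terms are generated by $$t ::= \bot \mid \omega(s_1,\dots,s_k)\mid r(t,\dots,t)\mid \mathsf{if}\ \varphi\ \mathsf{then}\ t\ \mathsf{else}\ t\mid \sum_{\bar x:\varphi}t,$$ where $\omega$ is a $k$-ary weight function symbol, the $s_i$ are first-order terms, $r$ is a rational function with rational coefficients, $\varphi$ is a formula, and $\bar x$ is a tuple of variables, which the sum binds. Arithmetic operations and sums with an argument $\bot$ and divisions by zero have value $\bot$; moreover $\bot<a$ for every $a\in\mathbb R$. \emph{Networks.} For $m,\ell\ge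 1$, let $\mathbf F(m,\ell)$ be the class of layered feedforward networks with $m$ inputs, $\ell-1$ hidden layers of ReLU neurons, and one output with identity activation: finite directed graphs with real edge weights and with real biases on all non-input nodes, whose edges lead only from one layer (inputs, hidden layers, output) to the next. Let $F^{\mathcal N}:\mathbb R^m\to\mathbb R$ be the function represented by $\mathcal N$. A network $\mathcal N$ is viewed as an $\Upsilon^{\mathrm{net}}(m,1)$-structure in the obvious way, with weight $w=0$ on pairs that are not edges and bias $b=\bot$ on inputs. \emph{Theorem.} Let $m\ge 1$ and let $\varphi$ be a closed $\mathrm{FO(SUM)}$ formula over $\Upsilon^{\mathrm{net}}(m,1)$ that is fully model agnostic, that is, for every $\ell\ge1$ and all $\mathcal N,\mathcal N'\in\bigcup_{i=1}^{\ell}\mathbf F(m,i)$ with $F^{\mathcal N}=F^{\mathcal N'}$ we have $\mathcal N\models\varphi\Leftrightarrow\mathcal N'\models\varphi$. Then either $\mathcal N\models\varphi$ for all $\mathcal N\in\bigcup_{\ell\ge1}\mathbf F(m,\ell)$, or $\mathcal N\not\models\varphi$ for all $\mathcal N\in\bigcup_{\ell\ge1}\mathbf F(m,\ell)$. -/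

import Mathlib

noncomputable section

/-! ### Weighted vocabularies and finite weighted structures -/

/-- The lifted reals: the reals together with an extra value `⊥` ("undefined"). In `WithBot ℝ`
the value `⊥` lies strictly below every real, and a sum having `⊥` as a summand equals `⊥`. -/
abbrev LiftedReal : Type := WithBot ℝ

/-- A vocabulary: function and relation symbols (a first-order language), and in addition
weight function symbols, each with an arity. -/
structure WVocabulary where
  lang : FirstOrder.Language.{0, 0}
  Weights : ℕ → Type

/-- A finite structure over a vocabulary: a finite domain, interpretations of the function and
relation symbols, and lifted-real valued interpretations of the weight function symbols. -/
structure WStructure (V : WVocabulary) where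
  Dom : Type
  [fin : Fintype Dom]
  [str : V.lang.Structure Dom]
  weight : ∀ {k : ℕ}, V.Weights k → (Fin k → Dom) → LiftedReal

attribute [instance] WStructure.fin WStructure.str

/-! ### Syntax and semantics of FO(SUM) -/

namespace FOSum

mutual

/-- FO(SUM) formulas whose free variables are among `n` variables, indexed by `Fin n`. The
variables bound by a quantifier or a summation are appended at the end. The connectives and
quantifiers not listed are the usual abbreviations. -/
inductive Formula (V : WVocabulary) : ℕ → Type
  | equal {n : ℕ} (s₁ s₂ : V.lang.Term (Fin n)) : Formula V n
  | rel {n k : ℕ} (R : V.lang.Relations k) (s : Fin k → V.lang.Term (Fin n)) : Formula V n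
  | wEqual {n : ℕ} (t₁ t₂ : WTerm V n) : Formula V n
  | wLess {n : ℕ} (t₁ t₂ : WTerm V n) : Formula V n
  | neg {n : ℕ} (φ : Formula V n) : Formula V n
  | conj {n : ℕ} (φ ψ : Formula V n) : Formula V n
  | ex {n : ℕ} (φ : Formula V (n + 1)) : Formula V n

/-- FO(SUM) weight terms whose free variables are among `n` variables:
`⊥`, `w(s₁, …, sₖ)`, `r(t₁, …, tₖ)` for a rational function `r = P / Q` with rational
coefficients, `if φ then t₁ else t₂`, and the sum of `t` over all `k`-tuples satisfying `φ`. -/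
inductive WTerm (V : WVocabulary) : ℕ → Type
  | bot {n : ℕ} : WTerm V n
  | weight {n k : ℕ} (w : V.Weights k) (s : Fin k → V.lang.Term (Fin n)) : WTerm V n
  | ratFun {n k : ℕ} (P Q : MvPolynomial (Fin k) ℚ) (hQ : Q ≠ 0) (t : Fin k → WTerm V n) :
      WTerm V n
  | ite {n : ℕ} (φ : Formula V n) (t₁ t₂ : WTerm V n) : WTerm V n
  | sum {n : ℕ} (k : ℕ) (φ : Formula V (n + k)) (t : WTerm V (n + k)) : WTerm V n

end

open Classical in
/-- The value of the rational function `P / Q` on lifted reals: `⊥` if some argument is `⊥` or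
if the denominator vanishes. -/
def ratValue {k : ℕ} (P Q : MvPolynomial (Fin k) ℚ) (a : Fin k → LiftedReal) : LiftedReal :=
  if h : ∀ i, a i ≠ ⊥ then
    if MvPolynomial.aeval (fun i => (a i).unbot (h i)) Q = (0 : ℝ) then ⊥
    else ((MvPolynomial.aeval (fun i => (a i).unbot (h i)) P /
      MvPolynomial.aeval (fun i => (a i).unbot (h i)) Q : ℝ) : LiftedReal)
  else ⊥

mutual

/-- Truth of a formula in a structure under an assignment of the free variables. -/
def Formula.Holds {V : WVocabulary} (A : WStructure V) :
    {n : ℕ} → Formula V n → (Fin n → A.Dom) → Prop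
  | _, .equal s₁ s₂, a => s₁.realize a = s₂.realize a
  | _, .rel R s, a => FirstOrder.Language.Structure.RelMap R (fun i => (s i).realize a)
  | _, .wEqual t₁ t₂, a => t₁.value A a = t₂.value A a
  | _, .wLess t₁ t₂, a => t₁.value A a < t₂.value A a
  | _, .neg φ, a => ¬ φ.Holds A a
  | _, .conj φ ψ, a => φ.Holds A a ∧ ψ.Holds A a
  | _, .ex φ, a => ∃ d : A.Dom, φ.Holds A (Fin.snoc a d)

/-- The value of a weight term in a structure under an assignment of the free variables. -/
def WTerm.value {V : WVocabulary} (A : WStructure V) :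
    {n : ℕ} → WTerm V n → (Fin n → A.Dom) → LiftedReal
  | _, .bot, _ => ⊥
  | _, .weight w s, a => A.weight w (fun i => (s i).realize a)
  | _, .ratFun P Q _ t, a => ratValue P Q (fun i => (t i).value A a)
  | _, .ite φ t₁ t₂, a => open Classical in
      if φ.Holds A a then t₁.value A a else t₂.value A a
  | _, .sum k φ t, a => open Classical in
      ∑ d : Fin k → A.Dom,
        if φ.Holds A (Fin.append a d) then t.value A (Fin.append a d) else 0

end

/-- A closed formula: one without free variables. -/
abbrev Sentence (V : WVocabulary) : Type := Formula V 0

end FOSum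

/-- `A.Models φ`: the closed formula `φ` is true in the structure `A`. -/
def WStructure.Models {V : WVocabulary} (A : WStructure V) (φ : FOSum.Sentence V) : Prop :=
  φ.Holds A Fin.elim0

/-! ### Neural networks -/

/-- A ReLU feedforward network with `m` inputs and `n` outputs: a finite acyclic directed graph
with distinguished, linearly ordered inputs (sources) and outputs (sinks), a weight on every edge
and a bias on every node other than the inputs. The values of `weight` on pairs that are not
edges and of `bias` on inputs carry no meaning and are never used. -/
structure ReLUNet (m n : ℕ) where
  Node : Type
  [fin : Fintype Node]
  Edge : Node → Node → Prop
  acyclic : ∀ u, ¬ Relation.TransGen Edge u u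
  inp : Fin m ↪ Node
  out : Fin n ↪ Node
  inp_source : ∀ i u, ¬ Edge u (inp i)
  out_sink : ∀ j u, ¬ Edge (out j) u
  inp_ne_out : ∀ i j, inp i ≠ out j
  weight : Node → Node → ℝ
  bias : Node → ℝ

attribute [instance] ReLUNet.fin

namespace ReLUNet

variable {m n : ℕ}

theorem wellFounded_edge (N : ReLUNet m n) : WellFounded N.Edge := by
  have : Std.Irrefl (Relation.TransGen N.Edge) := ⟨N.acyclic⟩
  exact Subrelation.wf (fun h => Relation.TransGen.single h)
    (Finite.wellFounded_of_trans_of_irrefl (Relation.TransGen N.Edge))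

open Classical in
/-- The function represented by a node, at the input vector `x`, by recursion along the edges. -/
def nodeFun (N : ReLUNet m n) (x : Fin m → ℝ) : N.Node → ℝ :=
  N.wellFounded_edge.fix fun u val =>
    if h : ∃ i, N.inp i = u then x h.choose
    else if ∃ j, N.out j = u then
      N.bias u + ∑ v : {v // N.Edge v u}, N.weight v u * val v v.2
    else max 0 (N.bias u + ∑ v : {v // N.Edge v u}, N.weight v u * val v v.2)

/-- The function represented by the network. -/
def func (N : ReLUNet m n) (x : Fin m → ℝ) : Fin n → ℝ := fun j => N.nodeFun x (N.out j)

theorem nodeFun_inp (N : ReLUNet m n) (x : Fin m → ℝ) (i : Fin m) :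
    N.nodeFun x (N.inp i) = x i := by
  have h : ∃ i', N.inp i' = N.inp i := ⟨i, rfl⟩
  rw [nodeFun, WellFounded.fix_eq, dif_pos h, N.inp.injective h.choose_spec]

open Classical in
theorem nodeFun_out (N : ReLUNet m n) (x : Fin m → ℝ) (j : Fin n) :
    N.nodeFun x (N.out j) = N.bias (N.out j) +
      ∑ v : {v // N.Edge v (N.out j)}, N.weight v (N.out j) * N.nodeFun x v := by
  have h : ¬ ∃ i, N.inp i = N.out j := fun ⟨i, hi⟩ => N.inp_ne_out i j hi
  have h' : ∃ j', N.out j' = N.out j := ⟨j, rfl⟩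
  rw [nodeFun, WellFounded.fix_eq, dif_neg h, if_pos h']

open Classical in
theorem nodeFun_hidden (N : ReLUNet m n) (x : Fin m → ℝ) (u : N.Node)
    (hi : ∀ i, N.inp i ≠ u) (ho : ∀ j, N.out j ≠ u) :
    N.nodeFun x u = max 0 (N.bias u +
      ∑ v : {v // N.Edge v u}, N.weight v u * N.nodeFun x v) := by
  have h : ¬ ∃ i, N.inp i = u := fun ⟨i, h⟩ => hi i h
  have h' : ¬ ∃ j, N.out j = u := fun ⟨j, h⟩ => ho j h
  rw [nodeFun, WellFounded.fix_eq, dif_neg h, if_neg h']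

end ReLUNet

/-- The class `F(m, ℓ)` of layered networks with `m` inputs, a single output, and depth `ℓ`:
the nodes are arranged in layers `0, …, ℓ`, where layer `0` consists of the inputs, layer `ℓ` of
the output, layers `1, …, ℓ - 1` are the (nonempty) hidden layers, and every edge leads from a
layer to the next one. -/
def layeredNets (m ℓ : ℕ) : Set (ReLUNet m 1) :=
  {N | ∃ layer : N.Node → ℕ,
    (∀ u, layer u ≤ ℓ) ∧
    (∀ u, layer u = 0 ↔ ∃ i, N.inp i = u) ∧
    (∀ u, layer u = ℓ ↔ ∃ j, N.out j = u) ∧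
    (∀ k, 0 < k → k < ℓ → ∃ u, layer u = k) ∧
    (∀ u v, N.Edge u v → layer v = layer u + 1)}

/-! ### Networks as weighted structures -/

/-- Constant symbols for the inputs and the outputs. -/
inductive NetFunctions (m n : ℕ) : ℕ → Type
  | inp (i : Fin m) : NetFunctions m n 0
  | out (j : Fin n) : NetFunctions m n 0

/-- A binary relation symbol for the edges. -/
inductive NetRelations : ℕ → Type
  | edge : NetRelations 2

/-- A unary weight function symbol for the biases, a binary one for the edge weights. -/
inductive NetWeights : ℕ → Type
  | bias : NetWeights 1
  | weight : NetWeights 2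

/-- The vocabulary of networks with `m` inputs and `n` outputs. -/
def netVocabulary (m n : ℕ) : WVocabulary where
  lang := ⟨NetFunctions m n, NetRelations⟩
  Weights := NetWeights

open Classical in
/-- A network as a finite weighted structure: inputs have bias `⊥`, and non-edges have
weight `0`. -/
def ReLUNet.toStructure {m n : ℕ} (N : ReLUNet m n) : WStructure (netVocabulary m n) where
  Dom := N.Node
  str :=
    { funMap := fun {_} f _ =>
        match f with
        | NetFunctions.inp i => N.inp i
        | NetFunctions.out j => N.out j
      RelMap := fun {_} R =>
        match R with
        | NetRelations.edge => fun a => N.Edge (a 0) (a 1) }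
  weight := fun {_} w =>
    match w with
    | NetWeights.bias => fun a => if ∃ i, N.inp i = a 0 then ⊥ else (N.bias (a 0) : LiftedReal)
    | NetWeights.weight => fun a =>
        if N.Edge (a 0) (a 1) then (N.weight (a 0) (a 1) : LiftedReal) else 0

/-! ### Model agnosticity -/

/-- A closed formula is depth-`ℓ` model agnostic if it does not distinguish networks of depth
at most `ℓ` that represent the same function. -/
def IsDepthAgnostic {m : ℕ} (ℓ : ℕ) (φ : FOSum.Sentence (netVocabulary m 1)) : Prop :=
  ∀ N ∈ ⋃ i ∈ Set.Icc 1 ℓ, layeredNets m i, ∀ N' ∈ ⋃ i ∈ Set.Icc 1 ℓ, layeredNets m i,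
    N.func = N'.func → (N.toStructure.Models φ ↔ N'.toStructure.Models φ)

/-- A closed formula is fully model agnostic if it is depth-`ℓ` model agnostic for every
`ℓ ≥ 1`. -/
def IsFullyAgnostic {m : ℕ} (φ : FOSum.Sentence (netVocabulary m 1)) : Prop :=
  ∀ ℓ : ℕ, 1 ≤ ℓ → IsDepthAgnostic ℓ φ

end

/-!
A fully agnostic sentence has the same truth value in every network `N` as in some network
computing the zero function. Since any two networks computing zero are indistinguishable for it,
its truth value is constant.

Given a layered network `N` computing `f`, replace its output by long *strands*: the values
`max 0 f` and `max 0 (-f)` are carried through `M` further layers of neurons by edges of weight `1`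
along a first strand, while a second strand of the same shape carries only zeros. The output
recovers `f = max 0 f - max 0 (-f)` from the end of the first strand (`func_strandNet`). If the two
strands are crossed once on their way, the output reads the zeros instead. So it has to be shown
that a given sentence cannot see the crossing once `M` is large enough.

This is a locality property of FO(SUM) (`exists_holdsLocally`, `exists_valueLocal`). By induction
on a formula or weight term there is a radius `r`, independent of the network and of `M`, such that
its value at a tuple is not changed by a crossing at position `j`, provided that the tuple
contains no strand node at the positions `j, …, j + r`. The point is the summation over `k`-tuples
`d` (the existential quantifier is like the case `k = 1`). If the radius for the summand is `r`,
among the `k + 1` positions `j, j + (r + 1), …, j + k * (r + 1)` there is one, `j'`, such that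
a crossing there is far from `d`; choose `j'` in terms of the positions of the entries of `d` only.
Interchanging the two strands at the positions in `(j, j']` is an isomorphism from the network
crossed at `j'` to the one crossed at `j`, and moves neither the positions of `d` nor the
parameters of the summand. Applying it to `d` gives a permutation of the set of all `k`-tuples
which matches the summands of the uncrossed network with those of the network crossed at `j`
(`exists_equiv_tuple`).
-/

noncomputable section

/-! ### Isomorphisms of weighted structures -/

theorem Fin.comp_append {α β : Type*} {m n : ℕ} (g : α → β) (a : Fin m → α) (b : Fin n → α) :
    g ∘ Fin.append a b = Fin.append (g ∘ a) (g ∘ b) := by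
  funext i
  refine Fin.addCases (fun i => ?_) (fun i => ?_) i <;> simp

namespace WStructure

variable {V : WVocabulary} {A B : WStructure V}

open FirstOrder.Language

/-- An isomorphism of weighted structures: an isomorphism of the underlying first-order structures
which preserves the weight functions. -/
structure Iso (A B : WStructure V) where
  toEquiv : V.lang.Equiv A.Dom B.Dom
  weight_comp : ∀ {k : ℕ} (w : V.Weights k) (a : Fin k → A.Dom),
    B.weight w (toEquiv ∘ a) = A.weight w a

mutual

theorem Iso.holds_iff (e : A.Iso B) :
    ∀ {n : ℕ} (φ : FOSum.Formula V n) (a : Fin n → A.Dom), φ.Holds B (e.toEquiv ∘ a) ↔ φ.Holds A a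
  | _, .equal s₁ s₂, a => by
    simp only [FOSum.Formula.Holds, HomClass.realize_term]
    exact e.toEquiv.injective.eq_iff
  | _, .rel R s, a => by
    simp only [FOSum.Formula.Holds, HomClass.realize_term]
    exact StrongHomClass.map_rel e.toEquiv R fun i => (s i).realize a
  | _, .wEqual t₁ t₂, a => by
    rw [FOSum.Formula.Holds, FOSum.Formula.Holds, e.value_eq t₁, e.value_eq t₂]
  | _, .wLess t₁ t₂, a => by
    rw [FOSum.Formula.Holds, FOSum.Formula.Holds, e.value_eq t₁, e.value_eq t₂]
  | _, .neg φ, a => by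
    rw [FOSum.Formula.Holds, FOSum.Formula.Holds, e.holds_iff φ]
  | _, .conj φ ψ, a => by
    rw [FOSum.Formula.Holds, FOSum.Formula.Holds, e.holds_iff φ, e.holds_iff ψ]
  | _, .ex φ, a => by
    simp only [FOSum.Formula.Holds]
    rw [← e.toEquiv.toEquiv.exists_congr_right]
    refine exists_congr fun d => ?_
    rw [← e.holds_iff φ, Fin.comp_snoc]
    rfl

theorem Iso.value_eq (e : A.Iso B) :
    ∀ {n : ℕ} (t : FOSum.WTerm V n) (a : Fin n → A.Dom), t.value B (e.toEquiv ∘ a) = t.value A a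
  | _, .bot, a => by rw [FOSum.WTerm.value, FOSum.WTerm.value]
  | _, .weight w s, a => by
    simp only [FOSum.WTerm.value, HomClass.realize_term]
    exact e.weight_comp w fun i => (s i).realize a
  | _, .ratFun P Q _ t, a => by
    rw [FOSum.WTerm.value, FOSum.WTerm.value]
    congr 1
    funext i
    exact e.value_eq (t i) a
  | _, .ite φ t₁ t₂, a => by
    simp only [FOSum.WTerm.value, e.value_eq t₁, e.value_eq t₂]
    classical
    exact if_congr (e.holds_iff φ a) rfl rfl
  | _, .sum k φ t, a => by
    simp only [FOSum.WTerm.value]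
    refine (Fintype.sum_equiv ((Equiv.refl (Fin k)).arrowCongr e.toEquiv.toEquiv) _ _
      fun d => ?_).symm
    have h : Fin.append (e.toEquiv ∘ a) (((Equiv.refl (Fin k)).arrowCongr e.toEquiv.toEquiv) d) =
        e.toEquiv ∘ Fin.append a d := (Fin.comp_append e.toEquiv a d).symm
    rw [h, e.value_eq t]
    classical
    exact if_congr (e.holds_iff φ _).symm rfl rfl

end

end WStructure

/-! ### Prolonging a network by two strands -/

namespace ReLUNet

variable {m : ℕ}

/-- The sign attached to a strand node: `true` stands for the positive part of the carried value,
`false` for the negative part. -/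
def strandSign (s : Bool) : ℝ := if s then 1 else -1

/-- The nodes of `N` together with the strand nodes `(p, c, s)`: `p` is the position along the
strands, `c` says which of the two strands (`false` is the one that reads the output value of `N`
at position `0` and feeds the new output from position `M`), and `s` is the sign. -/
abbrev StrandNode (N : ReLUNet m 1) (M : ℕ) : Type := N.Node ⊕ (Fin (M + 1) × Bool × Bool)

/-- The edges of the prolonged network. The edges of `N` into its output are redirected to the
beginning of strand `false`, and the end of strand `false` is joined to the output. Between the
positions `p` and `p + 1` the two strands are crossed if `ε p` is `true`. -/
def strandEdge (N : ReLUNet m 1) (M : ℕ) (ε : ℕ → Bool) : N.StrandNode M → N.StrandNode M → Prop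
  | .inl u, .inl v => N.Edge u v ∧ v ≠ N.out 0
  | .inl u, .inr (p, c, _) => (p : ℕ) = 0 ∧ c = false ∧ N.Edge u (N.out 0)
  | .inr (p, c, s), .inr (q, c', s') => (q : ℕ) = p + 1 ∧ c' = xor c (ε p) ∧ s' = s
  | .inr (p, c, _), .inl v => (p : ℕ) = M ∧ c = false ∧ v = N.out 0

/-- The edge weights of the prolonged network. -/
def strandWeight (N : ReLUNet m 1) (M : ℕ) : N.StrandNode M → N.StrandNode M → ℝ
  | .inl u, .inl v => N.weight u v
  | .inl u, .inr (_, _, s) => strandSign s * N.weight u (N.out 0)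
  | .inr _, .inr _ => 1
  | .inr (_, _, s), .inl _ => strandSign s

open Classical in
/-- The biases of the prolonged network: the bias of the output of `N` moves to the beginning of
strand `false`. -/
def strandBias (N : ReLUNet m 1) (M : ℕ) : N.StrandNode M → ℝ
  | .inl u => if u = N.out 0 then 0 else N.bias u
  | .inr (p, c, s) => if (p : ℕ) = 0 ∧ c = false then strandSign s * N.bias (N.out 0) else 0

open Classical in
/-- The layering of the prolonged network, given one of `N`: strand position `0` takes the layer of
the former output. -/
def strandLayer (N : ReLUNet m 1) (M : ℕ) (lay : N.Node → ℕ) : N.StrandNode M → ℕ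
  | .inl u => if u = N.out 0 then lay (N.out 0) + M + 1 else lay u
  | .inr (p, _, _) => lay (N.out 0) + p

theorem strandLayer_eq_add_one {N : ReLUNet m 1} (M : ℕ) (ε : ℕ → Bool) {lay : N.Node → ℕ}
    (hlay : ∀ u v, N.Edge u v → lay v = lay u + 1) (x y : N.StrandNode M)
    (h : N.strandEdge M ε x y) : N.strandLayer M lay y = N.strandLayer M lay x + 1 := by
  have hout : ∀ {u v}, N.Edge u v → u ≠ N.out 0 := fun h h' => N.out_sink 0 _ (h' ▸ h)
  match x, y, h with
  | .inl u, .inl v, h => simp [strandLayer, h.2, hout h.1, hlay u v h.1]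
  | .inl u, .inr (p, c, _), h => simp [strandLayer, hout h.2.2, h.1, hlay _ _ h.2.2]
  | .inr (p, c, s), .inr (q, c', s'), h => simp [strandLayer, h.1, add_assoc]
  | .inr (p, c, _), .inl v, h => simp [strandLayer, h.1, h.2.2]

/-- The network `N`, prolonged by two strands of length `M`, crossed as prescribed by `ε`. The
layering `lay` serves only to see that the graph is acyclic. -/
def strandNet (N : ReLUNet m 1) (lay : N.Node → ℕ) (hlay : ∀ u v, N.Edge u v → lay v = lay u + 1)
    (M : ℕ) (ε : ℕ → Bool) : ReLUNet m 1 where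
  Node := N.StrandNode M
  Edge := N.strandEdge M ε
  acyclic u h := by
    have key : ∀ x y, Relation.TransGen (N.strandEdge M ε) x y →
        N.strandLayer M lay x < N.strandLayer M lay y := by
      intro x y h
      induction h with
      | single h => rw [strandLayer_eq_add_one M ε hlay _ _ h]; exact Nat.lt_succ_self _
      | tail _ h ih =>
        rw [strandLayer_eq_add_one M ε hlay _ _ h]
        exact ih.trans (Nat.lt_succ_self _)
    exact (key u u h).false
  inp := N.inp.trans Function.Embedding.inl
  out := N.out.trans Function.Embedding.inl
  inp_source i u h := by
    match u, h with
    | .inl u, h => exact N.inp_source i u h.1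
    | .inr _, h => exact N.inp_ne_out i 0 h.2.2
  out_sink j u h := by
    obtain rfl := Subsingleton.elim j 0
    match u, h with
    | .inl u, h => exact N.out_sink 0 u h.1
    | .inr _, h => exact N.out_sink 0 _ h.2.2
  inp_ne_out i j h := N.inp_ne_out i j (Sum.inl_injective h)
  weight := N.strandWeight M
  bias := N.strandBias M

variable {N : ReLUNet m 1} {lay : N.Node → ℕ} {hlay : ∀ u v, N.Edge u v → lay v = lay u + 1}

theorem strandNet_mem_layeredNets {ℓ : ℕ} (h1 : 1 ≤ ℓ) (M : ℕ) (ε : ℕ → Bool)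
    (hle : ∀ u, lay u ≤ ℓ) (hinp : ∀ u, lay u = 0 ↔ ∃ i, N.inp i = u)
    (hout : ∀ u, lay u = ℓ ↔ ∃ j, N.out j = u) (hmid : ∀ k, 0 < k → k < ℓ → ∃ u, lay u = k) :
    N.strandNet lay hlay M ε ∈ layeredNets m (ℓ + M + 1) := by
  have h0 : lay (N.out 0) = ℓ := (hout _).2 ⟨0, rfl⟩
  refine ⟨N.strandLayer M lay, ?_, ?_, ?_, ?_, strandLayer_eq_add_one M ε hlay⟩
  · rintro (u | ⟨p, c, s⟩)
    · have := hle u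
      simp only [strandLayer]
      split_ifs <;> omega
    · simp only [strandLayer]; omega
  · rintro (u | ⟨p, c, s⟩)
    · simp only [strandLayer]
      split_ifs with hu
      · subst hu
        refine iff_of_false not_false ?_
        rintro ⟨i, hi⟩
        exact N.inp_ne_out i 0 (Sum.inl_injective hi)
      · rw [hinp u]
        exact exists_congr fun i => Sum.inl_injective.eq_iff.symm
    · refine iff_of_false (by simp only [strandLayer]; omega) ?_
      rintro ⟨i, hi⟩
      exact absurd hi Sum.inl_ne_inr
  · rintro (u | ⟨p, c, s⟩)
    · simp only [strandLayer]
      split_ifs with hu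
      · exact iff_of_true (by omega) ⟨0, hu ▸ rfl⟩
      · have := hle u
        refine iff_of_false (by omega) ?_
        rintro ⟨j, hj⟩
        obtain rfl := Subsingleton.elim j 0
        exact hu (Sum.inl_injective hj).symm
    · refine iff_of_false (by simp only [strandLayer]; omega) ?_
      rintro ⟨i, hi⟩
      exact absurd hi Sum.inl_ne_inr
  · intro k hk hk'
    rcases lt_or_ge k ℓ with hkl | hkl
    · obtain ⟨u, hu⟩ := hmid k hk hkl
      refine ⟨Sum.inl u, ?_⟩
      have : u ≠ N.out 0 := by rintro rfl; omega
      simp [strandLayer, this, hu]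
    · refine ⟨Sum.inr (⟨k - ℓ, by omega⟩, false, false), ?_⟩
      simp only [strandLayer]; omega

open Classical in
theorem sum_edge_eq {k : ℕ} (A : ReLUNet m k) (u : A.Node) (g : A.Node → ℝ) :
    ∑ v : {v // A.Edge v u}, g v = ∑ v, if A.Edge v u then g v else 0 := by
  rw [← Finset.sum_filter]
  exact (Finset.sum_subtype _ (by simp) g).symm

/-- The function represented by a node of the prolonged network, on the explicit type of its
nodes. -/
def strandFun (N : ReLUNet m 1) (lay : N.Node → ℕ) (hlay : ∀ u v, N.Edge u v → lay v = lay u + 1)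
    (M : ℕ) (ε : ℕ → Bool) (x : Fin m → ℝ) : N.StrandNode M → ℝ :=
  (N.strandNet lay hlay M ε).nodeFun x

open Classical in
theorem strandFun_hidden (M : ℕ) (ε : ℕ → Bool) (x : Fin m → ℝ) (y : N.StrandNode M)
    (hi : ∀ i, Sum.inl (N.inp i) ≠ y) (ho : Sum.inl (N.out 0) ≠ y) :
    N.strandFun lay hlay M ε x y = max 0 (N.strandBias M y +
      ((∑ v : N.Node, if N.strandEdge M ε (Sum.inl v) y then
        N.strandWeight M (Sum.inl v) y * N.strandFun lay hlay M ε x (Sum.inl v) else 0) +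
      ∑ v : Fin (M + 1) × Bool × Bool, if N.strandEdge M ε (Sum.inr v) y then
        N.strandWeight M (Sum.inr v) y * N.strandFun lay hlay M ε x (Sum.inr v) else 0)) := by
  refine ((N.strandNet lay hlay M ε).nodeFun_hidden x y hi fun j => ?_).trans ?_
  · rw [Subsingleton.elim j 0]; exact ho
  · refine congrArg (fun z => max 0 (N.strandBias M y + z)) ?_
    exact ((N.strandNet lay hlay M ε).sum_edge_eq y fun v =>
      N.strandWeight M v y * N.strandFun lay hlay M ε x v).trans (Fintype.sum_sum_type _)

open Classical in
theorem strandFun_out (M : ℕ) (ε : ℕ → Bool) (x : Fin m → ℝ) :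
    N.strandFun lay hlay M ε x (Sum.inl (N.out 0)) =
      ∑ v : Fin (M + 1) × Bool × Bool, if N.strandEdge M ε (Sum.inr v) (Sum.inl (N.out 0)) then
        N.strandWeight M (Sum.inr v) (Sum.inl (N.out 0)) *
          N.strandFun lay hlay M ε x (Sum.inr v) else 0 := by
  refine ((N.strandNet lay hlay M ε).nodeFun_out x 0).trans ?_
  have hb : (N.strandNet lay hlay M ε).bias ((N.strandNet lay hlay M ε).out 0) = 0 :=
    if_pos rfl
  rw [hb, zero_add]
  refine (((N.strandNet lay hlay M ε).sum_edge_eq _ fun v =>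
      N.strandWeight M v (Sum.inl (N.out 0)) * N.strandFun lay hlay M ε x v).trans
    (Fintype.sum_sum_type _)).trans ?_
  refine (congrArg (· + _) (Finset.sum_eq_zero fun v _ => if_neg fun h => h.2 rfl)).trans ?_
  exact zero_add _

theorem strandFun_inl (M : ℕ) (ε : ℕ → Bool) (x : Fin m → ℝ) (u : N.Node)
    (hu : u ≠ N.out 0) : N.strandFun lay hlay M ε x (Sum.inl u) = N.nodeFun x u := by
  classical
  induction u using N.wellFounded_edge.induction with
  | _ u ih =>
  by_cases hi : ∃ i, N.inp i = u
  · obtain ⟨i, rfl⟩ := hi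
    rw [nodeFun_inp]
    exact nodeFun_inp (N.strandNet lay hlay M ε) x i
  · push Not at hi
    rw [nodeFun_hidden N x u hi (fun j h => hu (by rw [← h, Subsingleton.elim j 0])),
      strandFun_hidden M ε x (Sum.inl u) (fun i h => hi i (Sum.inl_injective h))
        (fun h => hu (Sum.inl_injective h).symm),
      sum_edge_eq N u fun v => N.weight v u * N.nodeFun x v,
      Finset.sum_eq_zero (s := (Finset.univ : Finset (Fin (M + 1) × Bool × Bool)))
        fun v _ => if_neg fun h => hu h.2.2, add_zero]
    congr 2
    · exact if_neg hu
    · refine Finset.sum_congr rfl fun v _ => ?_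
      by_cases hv : N.Edge v u
      · rw [if_pos hv, if_pos ⟨hv, hu⟩, ih v hv fun h => N.out_sink 0 u (h ▸ hv)]
        rfl
      · rw [if_neg hv, if_neg fun h => hv h.1]

/-- The strand that carries the output value of `N` at position `p`: the parity of the number of
crossings before `p`. -/
def strandParity (ε : ℕ → Bool) : ℕ → Bool
  | 0 => false
  | p + 1 => xor (strandParity ε p) (ε p)

/-- The strand prescribed by the parity of the crossings carries the positive and the negative part
of the output value of `N`, and the other strand carries zeros. -/
theorem strandFun_inr (M : ℕ) (ε : ℕ → Bool) (x : Fin m → ℝ) (p : ℕ) (hp : p < M + 1)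
    (c s : Bool) : N.strandFun lay hlay M ε x (Sum.inr (⟨p, hp⟩, c, s)) =
      if c = strandParity ε p then max 0 (strandSign s * N.func x 0) else 0 := by
  classical
  induction p generalizing c with
  | zero =>
    rw [strandFun_hidden M ε x _ (fun i h => Sum.inl_ne_inr h) Sum.inl_ne_inr,
      Finset.sum_eq_zero (s := (Finset.univ : Finset (Fin (M + 1) × Bool × Bool)))
        fun v _ => if_neg fun h => absurd h.1 (Nat.succ_ne_zero _).symm, add_zero,
      func, nodeFun_out, sum_edge_eq N _ fun v => N.weight v (N.out 0) * N.nodeFun x v, mul_add,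
      Finset.mul_sum]
    by_cases hc : c = false
    · rw [if_pos (by simpa [strandParity] using hc)]
      congr 2
      · exact if_pos ⟨rfl, hc⟩
      · refine Finset.sum_congr rfl fun v _ => ?_
        by_cases hv : N.Edge v (N.out 0)
        · rw [if_pos hv, if_pos ⟨rfl, hc, hv⟩,
            strandFun_inl M ε x v fun h => N.out_sink 0 (N.out 0) (h ▸ hv), ← mul_assoc]
          rfl
        · rw [if_neg hv, if_neg fun h => hv h.2.2, mul_zero]
    · rw [if_neg (by simpa [strandParity] using hc), Finset.sum_eq_zero fun v _ =>
        if_neg fun h => hc h.2.1]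
      simp [strandBias, hc]
  | succ p ih =>
    have hsum : (∑ v : Fin (M + 1) × Bool × Bool,
        if N.strandEdge M ε (Sum.inr v) (Sum.inr (⟨p + 1, hp⟩, c, s)) then
          N.strandWeight M (Sum.inr v) (Sum.inr (⟨p + 1, hp⟩, c, s)) *
            N.strandFun lay hlay M ε x (Sum.inr v) else 0) =
        N.strandFun lay hlay M ε x (Sum.inr (⟨p, by omega⟩, xor c (ε p), s)) := by
      rw [Finset.sum_eq_single (⟨p, by omega⟩, xor c (ε p), s), if_pos ⟨rfl, by simp, rfl⟩]
      · exact one_mul _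
      · rintro ⟨⟨q, hq⟩, c', s'⟩ - hne
        refine if_neg fun h => hne ?_
        obtain ⟨h1, h2, h3⟩ := h
        obtain rfl : p = q := Nat.succ_injective h1
        simp [h2, h3]
      · exact fun h => absurd (Finset.mem_univ _) h
    have hb : N.strandBias M (Sum.inr (⟨p + 1, hp⟩, c, s)) = 0 := by simp [strandBias]
    have hc : (xor c (ε p) = strandParity ε p) ↔ c = strandParity ε (p + 1) := by
      rw [strandParity]
      cases c <;> cases ε p <;> cases strandParity ε p <;> simp
    rw [strandFun_hidden M ε x _ (fun i h => Sum.inl_ne_inr h) Sum.inl_ne_inr, hsum, ih, hb,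
      Finset.sum_eq_zero (s := (Finset.univ : Finset N.Node))
        fun v _ => if_neg fun h => absurd h.1 (Nat.succ_ne_zero _), zero_add, zero_add,
      if_congr hc rfl rfl]
    split_ifs <;> simp

theorem func_strandNet (M : ℕ) (ε : ℕ → Bool) (x : Fin m → ℝ) :
    (N.strandNet lay hlay M ε).func x 0 = if strandParity ε M = false then N.func x 0 else 0 := by
  classical
  refine (strandFun_out M ε x).trans ?_
  rw [Fintype.sum_prod_type, Finset.sum_eq_single (Fin.last M) (fun p _ hp =>
      Finset.sum_eq_zero fun v _ => if_neg fun h => hp (Fin.ext h.1))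
      (fun h => absurd (Finset.mem_univ _) h), Fintype.sum_prod_type, Fintype.sum_bool,
    Finset.sum_eq_zero fun v _ => if_neg (fun h => absurd h.2.1 Bool.true_eq_false_eq_False),
    zero_add, Fintype.sum_bool, if_pos ⟨rfl, rfl, rfl⟩, if_pos ⟨rfl, rfl, rfl⟩, Fin.last,
    strandFun_inr, strandFun_inr]
  by_cases h : strandParity ε M = false
  · rcases le_total 0 (N.func x 0) with h' | h' <;> simp [strandWeight, strandSign, h, h']
  · simp [h]

/-! ### Crossings far away from a tuple -/

/-- The position of a strand node; the nodes of `N` have none. -/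
def strandPos (N : ReLUNet m 1) (M : ℕ) : N.StrandNode M → Option ℕ
  | .inl _ => none
  | .inr (p, _, _) => some p

/-- A node whose position is `o` does not lie at any of the positions `j, …, j + r`. -/
def Avoids (r j : ℕ) (o : Option ℕ) : Prop := ∀ p ∈ o, p < j ∨ j + r < p

theorem Avoids.mono {r j r' j' : ℕ} {o : Option ℕ} (h : Avoids r j o) (hj : j ≤ j')
    (hr : j' + r' ≤ j + r) : Avoids r' j' o := fun p hp => by
  have := h p hp
  omega

/-- Each of `k` positions meets at most one of the `k + 1` disjoint blocks of length `r + 1`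
following `j`, hence some block is met by none. -/
theorem exists_avoids (r k j : ℕ) (o : Fin k → Option ℕ) :
    ∃ j', j ≤ j' ∧ j' ≤ j + k * (r + 1) ∧ ∀ i, Avoids r j' (o i) := by
  by_contra! hcon
  have h : ∀ l : Fin (k + 1), ∃ i, ¬ Avoids r (j + l * (r + 1)) (o i) := fun l =>
    hcon _ (Nat.le_add_right _ _)
      (Nat.add_le_add_left (Nat.mul_le_mul_right _ (Nat.lt_succ_iff.1 l.2)) _)
  choose i hi using h
  obtain ⟨l, l', hne, hll⟩ := Fintype.exists_ne_map_eq_of_card_lt i (by simp)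
  have h1 := hi l
  have h2 := hi l'
  rw [hll] at h1
  simp only [Avoids, not_forall, not_or, not_lt] at h1 h2
  obtain ⟨p, hp, h1⟩ := h1
  obtain ⟨q, hq, h2⟩ := h2
  obtain rfl : p = q := Option.mem_unique hp hq
  rcases lt_or_gt_of_ne (Fin.val_ne_of_ne hne) with hlt | hlt
  · have := Nat.mul_le_mul_right (r + 1) (Nat.succ_le_of_lt hlt)
    rw [Nat.succ_mul] at this
    omega
  · have := Nat.mul_le_mul_right (r + 1) (Nat.succ_le_of_lt hlt)
    rw [Nat.succ_mul] at this
    omega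

/-- Interchange the two strands at the positions where `s` is `true`. -/
def strandSwap (N : ReLUNet m 1) (M : ℕ) (s : ℕ → Bool) : N.StrandNode M ≃ N.StrandNode M where
  toFun
    | .inl u => .inl u
    | .inr (p, c, t) => .inr (p, xor c (s p), t)
  invFun
    | .inl u => .inl u
    | .inr (p, c, t) => .inr (p, xor c (s p), t)
  left_inv x := by rcases x with u | ⟨p, c, t⟩ <;> simp
  right_inv x := by rcases x with u | ⟨p, c, t⟩ <;> simp

theorem strandSwap_strandSwap (N : ReLUNet m 1) (M : ℕ) (s : ℕ → Bool) (x : N.StrandNode M) :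
    N.strandSwap M s (N.strandSwap M s x) = x := (N.strandSwap M s).left_inv x

theorem strandPos_strandSwap (N : ReLUNet m 1) (M : ℕ) (s : ℕ → Bool) (x : N.StrandNode M) :
    N.strandPos M (N.strandSwap M s x) = N.strandPos M x := by
  rcases x with u | ⟨p, c, t⟩ <;> rfl

/-- A single crossing, between the positions `j` and `j + 1`. -/
def crossAt (j : ℕ) : ℕ → Bool := fun p => decide (p = j)

/-- The positions in the interval `(j, j']`. -/
def between (j j' : ℕ) : ℕ → Bool := fun p => decide (j < p ∧ p ≤ j')

theorem strandSwap_between_eq {N : ReLUNet m 1} {M j j' : ℕ} {x : N.StrandNode M}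
    (h : Avoids (j' - j) j (N.strandPos M x)) : N.strandSwap M (between j j') x = x := by
  rcases x with u | ⟨p, c, t⟩
  · rfl
  · have h1 := h p rfl
    have h2 : between j j' p = false := by
      rw [between, decide_eq_false_iff_not]; omega
    simp [strandSwap, h2]

section
variable (N : ReLUNet m 1) (lay : N.Node → ℕ) (hlay : ∀ u v, N.Edge u v → lay v = lay u + 1)

/-- Interchanging the strands where `s` is `true` turns the crossings `ε` into `ε'`, which differ
from `ε` at the positions where `s` changes. The conditions at both ends keep the edges that join
the strands to the rest of the network. -/
theorem strandEdge_strandSwap {M : ℕ} {ε ε' s : ℕ → Bool} (h0 : s 0 = false) (hM : s M = false)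
    (hs : ∀ p, ε' p = xor (ε p) (xor (s p) (s (p + 1)))) (x y : N.StrandNode M) :
    N.strandEdge M ε' (N.strandSwap M s x) (N.strandSwap M s y) ↔ N.strandEdge M ε x y := by
  rcases x with u | ⟨p, c, t⟩ <;> rcases y with v | ⟨q, c', t'⟩
  · rfl
  · refine and_congr_right fun hq => ?_
    rw [hq, h0, Bool.xor_false]
  · refine and_congr_right fun hq => ?_
    rw [hq, hM, Bool.xor_false]
  · refine and_congr_right fun hq => and_congr_left fun _ => ?_
    rw [hq, hs]
    cases c <;> cases c' <;> cases ε p <;> cases s p <;> cases s (p + 1) <;> simp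

theorem strandBias_strandSwap {M : ℕ} {s : ℕ → Bool} (h0 : s 0 = false) (x : N.StrandNode M) :
    N.strandBias M (N.strandSwap M s x) = N.strandBias M x := by
  rcases x with u | ⟨p, c, t⟩
  · rfl
  · refine if_congr (and_congr_right fun hp => ?_) rfl rfl
    rw [hp, h0, Bool.xor_false]

/-- The prolonged network as a weighted structure. It agrees definitionally with
`(N.strandNet lay hlay M ε).toStructure`, but its domain is reducibly the type of strand nodes,
so that a tuple makes sense for all choices of `ε` at once. -/
abbrev strandStructure (M : ℕ) (ε : ℕ → Bool) : WStructure (netVocabulary m 1) where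
  Dom := N.StrandNode M
  fin := inferInstance
  str := (N.strandNet lay hlay M ε).toStructure.str
  weight := (N.strandNet lay hlay M ε).toStructure.weight

theorem inp_eq_strandSwap_iff {M : ℕ} {s : ℕ → Bool} (i : Fin m) (x : N.StrandNode M) :
    Sum.inl (N.inp i) = N.strandSwap M s x ↔ Sum.inl (N.inp i) = x := by
  rcases x with u | ⟨p, c, t⟩
  · rfl
  · simp [strandSwap]

/-- Interchanging the strands as an isomorphism between prolonged networks. -/
def strandSwapIso {M : ℕ} {ε ε' s : ℕ → Bool} (h0 : s 0 = false) (hM : s M = false)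
    (hs : ∀ p, ε' p = xor (ε p) (xor (s p) (s (p + 1)))) :
    (N.strandStructure lay hlay M ε).Iso (N.strandStructure lay hlay M ε') where
  toEquiv :=
    @FirstOrder.Language.Equiv.mk _ _ _ (N.strandStructure lay hlay M ε).str
      (N.strandStructure lay hlay M ε').str (N.strandSwap M s)
      (fun f a => by cases f <;> rfl)
      (fun R a => by
        cases R
        exact N.strandEdge_strandSwap h0 hM hs (a 0) (a 1))
  weight_comp w a := by
    classical
    cases w
    · refine if_congr (exists_congr fun i => N.inp_eq_strandSwap_iff i (a 0)) rfl ?_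
      exact congrArg _ (N.strandBias_strandSwap h0 (a 0))
    · refine if_congr (N.strandEdge_strandSwap h0 hM hs (a 0) (a 1)) (congrArg _ ?_) rfl
      change N.strandWeight M (N.strandSwap M s (a 0)) (N.strandSwap M s (a 1)) =
        N.strandWeight M (a 0) (a 1)
      rcases a 0 with u | ⟨p, c, t⟩ <;> rcases a 1 with v | ⟨q, c', t'⟩ <;> rfl

/-- The back-and-forth step. If the parameters `a` are far from `j`, the `k`-tuples can be permuted
so that the network crossed at `j` looks from `(a, τ d)` like the network crossed at a suitable
`j'`, depending on `d`, looks from `(a, d)`, where `j'` is far from `a` and `d`. -/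
theorem exists_equiv_tuple {n : ℕ} (r k M j : ℕ) (a : Fin n → N.StrandNode M)
    (hM : j + (k * (r + 1) + r) < M)
    (ha : ∀ i, Avoids (k * (r + 1) + r) j (N.strandPos M (a i))) :
    ∃ τ : (Fin k → N.StrandNode M) ≃ (Fin k → N.StrandNode M), ∀ d, ∃ j', j' + r < M ∧
      (∀ i, Avoids r j' (N.strandPos M (Fin.append a d i))) ∧
      ∃ e : (N.strandStructure lay hlay M (crossAt j')).Iso
          (N.strandStructure lay hlay M (crossAt j)),
        Fin.append a (τ d) = e.toEquiv ∘ Fin.append a d := by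
  choose J hJ hJ' hJa using exists_avoids r k j
  -- `J` sees only the positions of a tuple, which `σ d` preserves;
  -- so `d ↦ σ d ∘ d` is an involution.
  let σ (d : Fin k → N.StrandNode M) :=
    N.strandSwap M (between j (J (N.strandPos M ∘ d)))
  have hpos : ∀ d, N.strandPos M ∘ (σ d ∘ d) = N.strandPos M ∘ d := fun d =>
    funext fun i => N.strandPos_strandSwap M _ _
  have hinv : Function.Involutive fun d => σ d ∘ d := fun d => by
    have : σ (σ d ∘ d) = σ d := by simp only [σ]; rw [hpos]
    simp only [this]
    exact funext fun i => N.strandSwap_strandSwap M _ _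
  refine ⟨hinv.toPerm _, fun d => ?_⟩
  have h1 := hJ (N.strandPos M ∘ d)
  have h2 := hJ' (N.strandPos M ∘ d)
  have h3 := hJa (N.strandPos M ∘ d)
  have hd : hinv.toPerm _ d = N.strandSwap M (between j (J (N.strandPos M ∘ d))) ∘ d := rfl
  rw [hd]
  generalize J (N.strandPos M ∘ d) = j' at h1 h2 h3
  refine ⟨j', by omega, fun i => ?_, N.strandSwapIso lay hlay (s := between j j')
    (by simp [between]) (by rw [between, decide_eq_false_iff_not]; omega) (fun p => ?_), ?_⟩
  · refine Fin.addCases (fun i => ?_) (fun i => ?_) i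
    · rw [Fin.append_left]; exact (ha i).mono h1 (by omega)
    · rw [Fin.append_right]; exact h3 i
  · simp only [crossAt, between]
    rw [Bool.eq_iff_iff]
    by_cases h4 : p = j' <;> by_cases h5 : j < p ∧ p ≤ j' <;>
      by_cases h6 : j < p + 1 ∧ p + 1 ≤ j' <;> simp [h4, h5, h6] <;> omega
  · refine Eq.trans ?_ (Fin.comp_append _ a d).symm
    congr 1
    exact funext fun i => (strandSwap_between_eq ((ha i).mono le_rfl (by omega))).symm

end

variable {N : ReLUNet m 1} {lay : N.Node → ℕ} {hlay : ∀ u v, N.Edge u v → lay v = lay u + 1}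

theorem strandEdge_crossAt_iff {M j : ℕ} {x y : N.StrandNode M}
    (h : Avoids 0 j (N.strandPos M x)) :
    N.strandEdge M (fun _ => false) x y ↔ N.strandEdge M (crossAt j) x y := by
  rcases x with u | ⟨p, c, t⟩ <;> rcases y with v | ⟨q, c', t'⟩
  · rfl
  · rfl
  · rfl
  · have := h p rfl
    have h2 : crossAt j p = false := by rw [crossAt, decide_eq_false_iff_not]; omega
    simp only [strandEdge, h2]

theorem realize_strandStructure_eq {n M : ℕ} (ε ε' : ℕ → Bool)
    (s : (netVocabulary m 1).lang.Term (Fin n)) (a : Fin n → N.StrandNode M) :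
    @FirstOrder.Language.Term.realize _ _ (N.strandStructure lay hlay M ε).str _ a s =
      @FirstOrder.Language.Term.realize _ _ (N.strandStructure lay hlay M ε').str _ a s := by
  cases s with
  | var i => rfl
  | func f ts => cases f <;> rfl

theorem avoids_realize {n M r j : ℕ} (ε : ℕ → Bool)
    (s : (netVocabulary m 1).lang.Term (Fin n)) (a : Fin n → N.StrandNode M)
    (ha : ∀ i, Avoids r j (N.strandPos M (a i))) :
    Avoids r j (N.strandPos M
      (@FirstOrder.Language.Term.realize _ _ (N.strandStructure lay hlay M ε).str _ a s)) := by
  cases s with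
  | var i => exact ha i
  | func f ts => cases f <;> exact fun p hp => nomatch hp

theorem weight_crossAt_eq {M j k : ℕ} (w : (netVocabulary m 1).Weights k)
    (b : Fin k → N.StrandNode M) (hb : ∀ i, Avoids 0 j (N.strandPos M (b i))) :
    (N.strandStructure lay hlay M fun _ => false).weight w b =
      (N.strandStructure lay hlay M (crossAt j)).weight w b := by
  classical
  cases w
  · rfl
  · exact if_congr (strandEdge_crossAt_iff (hb 0)) rfl rfl

theorem relMap_crossAt_iff {M j k : ℕ} (R : (netVocabulary m 1).lang.Relations k)
    (b : Fin k → N.StrandNode M) (hb : ∀ i, Avoids 0 j (N.strandPos M (b i))) :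
    (N.strandStructure lay hlay M fun _ => false).str.RelMap R b ↔
      (N.strandStructure lay hlay M (crossAt j)).str.RelMap R b := by
  cases R
  exact strandEdge_crossAt_iff (hb 0)

/-! ### Locality of FO(SUM) -/

open FOSum

/-- The truth of `φ` at a tuple is not affected by a crossing at `j`, provided that no entry of the
tuple lies at the positions `j, …, j + r`. -/
def HoldsLocally (r : ℕ) {n : ℕ} (φ : Formula (netVocabulary m 1) n) : Prop :=
  ∀ (N : ReLUNet m 1) (lay : N.Node → ℕ) (hlay : ∀ u v, N.Edge u v → lay v = lay u + 1)
    (M j : ℕ) (a : Fin n → N.StrandNode M), j + r < M →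
    (∀ i, Avoids r j (N.strandPos M (a i))) →
    (φ.Holds (N.strandStructure lay hlay M fun _ => false) a ↔
      φ.Holds (N.strandStructure lay hlay M (crossAt j)) a)

/-- The value of `t` at a tuple is not affected by a crossing at `j`, provided that no entry of the
tuple lies at the positions `j, …, j + r`. -/
def ValueLocal (r : ℕ) {n : ℕ} (t : WTerm (netVocabulary m 1) n) : Prop :=
  ∀ (N : ReLUNet m 1) (lay : N.Node → ℕ) (hlay : ∀ u v, N.Edge u v → lay v = lay u + 1)
    (M j : ℕ) (a : Fin n → N.StrandNode M), j + r < M →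
    (∀ i, Avoids r j (N.strandPos M (a i))) →
    t.value (N.strandStructure lay hlay M fun _ => false) a =
      t.value (N.strandStructure lay hlay M (crossAt j)) a

theorem HoldsLocally.mono {r r' n : ℕ} {φ : Formula (netVocabulary m 1) n}
    (h : HoldsLocally r φ) (hr : r ≤ r') : HoldsLocally r' φ :=
  fun N lay hlay M j a hM ha =>
    h N lay hlay M j a (by omega) fun i => (ha i).mono le_rfl (by omega)

theorem ValueLocal.mono {r r' n : ℕ} {t : WTerm (netVocabulary m 1) n}
    (h : ValueLocal r t) (hr : r ≤ r') : ValueLocal r' t :=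
  fun N lay hlay M j a hM ha =>
    h N lay hlay M j a (by omega) fun i => (ha i).mono le_rfl (by omega)

mutual

theorem exists_holdsLocally :
    ∀ {n : ℕ} (φ : Formula (netVocabulary m 1) n), ∃ r, HoldsLocally r φ
  | _, .equal s₁ s₂ => by
    refine ⟨0, fun N lay hlay M j a _ _ => ?_⟩
    rw [Formula.Holds, Formula.Holds]
    exact Eq.congr (realize_strandStructure_eq _ _ s₁ a) (realize_strandStructure_eq _ _ s₂ a)
  | _, .rel R s => by
    refine ⟨0, fun N lay hlay M j a _ ha => ?_⟩
    rw [Formula.Holds, Formula.Holds]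
    refine (relMap_crossAt_iff R _ fun i => avoids_realize _ (s i) a ha).trans ?_
    exact iff_of_eq (congrArg _ (funext fun i => realize_strandStructure_eq _ _ (s i) a))
  | _, .wEqual t₁ t₂ => by
    obtain ⟨r₁, h₁⟩ := exists_valueLocal t₁
    obtain ⟨r₂, h₂⟩ := exists_valueLocal t₂
    refine ⟨max r₁ r₂, fun N lay hlay M j a hM ha => ?_⟩
    rw [Formula.Holds, Formula.Holds,
      h₁.mono (le_max_left r₁ r₂) N lay hlay M j a hM ha,
      h₂.mono (le_max_right r₁ r₂) N lay hlay M j a hM ha]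
  | _, .wLess t₁ t₂ => by
    obtain ⟨r₁, h₁⟩ := exists_valueLocal t₁
    obtain ⟨r₂, h₂⟩ := exists_valueLocal t₂
    refine ⟨max r₁ r₂, fun N lay hlay M j a hM ha => ?_⟩
    rw [Formula.Holds, Formula.Holds,
      h₁.mono (le_max_left r₁ r₂) N lay hlay M j a hM ha,
      h₂.mono (le_max_right r₁ r₂) N lay hlay M j a hM ha]
  | _, .neg φ => by
    obtain ⟨r, h⟩ := exists_holdsLocally φ
    refine ⟨r, fun N lay hlay M j a hM ha => ?_⟩
    rw [Formula.Holds, Formula.Holds, h N lay hlay M j a hM ha]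
  | _, .conj φ ψ => by
    obtain ⟨r₁, h₁⟩ := exists_holdsLocally φ
    obtain ⟨r₂, h₂⟩ := exists_holdsLocally ψ
    refine ⟨max r₁ r₂, fun N lay hlay M j a hM ha => ?_⟩
    rw [Formula.Holds, Formula.Holds,
      h₁.mono (le_max_left r₁ r₂) N lay hlay M j a hM ha,
      h₂.mono (le_max_right r₁ r₂) N lay hlay M j a hM ha]
  | _, .ex φ => by
    obtain ⟨r, h⟩ := exists_holdsLocally φ
    refine ⟨1 * (r + 1) + r, fun N lay hlay M j a hM ha => ?_⟩
    obtain ⟨τ, hτ⟩ := N.exists_equiv_tuple lay hlay r 1 M j a hM ha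
    have snoc_iff : ∀ ε, (Formula.ex φ).Holds (N.strandStructure lay hlay M ε) a ↔
        ∃ d : Fin 1 → N.StrandNode M,
          φ.Holds (N.strandStructure lay hlay M ε) (Fin.append a d) := fun ε => by
      rw [Formula.Holds]
      constructor
      · rintro ⟨d, hd⟩
        exact ⟨fun _ => d, by rw [Fin.append_right_eq_snoc]; exact hd⟩
      · rintro ⟨d, hd⟩
        exact ⟨d 0, by rw [Fin.append_right_eq_snoc] at hd; exact hd⟩
    rw [snoc_iff, snoc_iff]
    refine (exists_congr fun d => ?_).trans τ.exists_congr_right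
    obtain ⟨j', hj', hd, e, had⟩ := hτ d
    rw [had]
    exact (h N lay hlay M j' _ hj' hd).trans (e.holds_iff φ _).symm

theorem exists_valueLocal :
    ∀ {n : ℕ} (t : WTerm (netVocabulary m 1) n), ∃ r, ValueLocal r t
  | _, .bot => ⟨0, fun N lay hlay M j a _ _ => by rw [WTerm.value, WTerm.value]⟩
  | _, .weight w s => by
    refine ⟨0, fun N lay hlay M j a _ ha => ?_⟩
    rw [WTerm.value, WTerm.value]
    refine (weight_crossAt_eq w _ fun i => avoids_realize _ (s i) a ha).trans ?_
    exact congrArg _ (funext fun i => realize_strandStructure_eq _ _ (s i) a)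
  | _, .ratFun P Q _ t => by
    choose r h using fun i => exists_valueLocal (t i)
    refine ⟨Finset.univ.sup r, fun N lay hlay M j a hM ha => ?_⟩
    rw [WTerm.value, WTerm.value]
    congr 1
    funext i
    exact (h i).mono (Finset.le_sup (Finset.mem_univ i)) N lay hlay M j a hM ha
  | _, .ite φ t₁ t₂ => by
    obtain ⟨r, h⟩ := exists_holdsLocally φ
    obtain ⟨r₁, h₁⟩ := exists_valueLocal t₁
    obtain ⟨r₂, h₂⟩ := exists_valueLocal t₂
    refine ⟨max r (max r₁ r₂), fun N lay hlay M j a hM ha => ?_⟩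
    simp only [WTerm.value]
    classical
    exact if_congr (h.mono (by omega) N lay hlay M j a hM ha)
      (h₁.mono (by omega) N lay hlay M j a hM ha) (h₂.mono (by omega) N lay hlay M j a hM ha)
  | _, .sum k φ t => by
    obtain ⟨r₁, h₁⟩ := exists_holdsLocally φ
    obtain ⟨r₂, h₂⟩ := exists_valueLocal t
    generalize hr : max r₁ r₂ = r
    refine ⟨k * (r + 1) + r, fun N lay hlay M j a hM ha => ?_⟩
    obtain ⟨τ, hτ⟩ := N.exists_equiv_tuple lay hlay r k M j a hM ha
    simp only [WTerm.value]
    refine Fintype.sum_equiv τ _ _ fun d => ?_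
    obtain ⟨j', hj', hd, e, had⟩ := hτ d
    rw [had]
    classical
    exact if_congr ((h₁.mono (by omega) N lay hlay M j' _ hj' hd).trans
        (e.holds_iff φ _).symm)
      ((h₂.mono (by omega) N lay hlay M j' _ hj' hd).trans
        (e.value_eq t _).symm) rfl

end

theorem strandParity_crossAt_zero (M : ℕ) : strandParity (crossAt 0) (M + 1) = true := by
  induction M with
  | zero => rfl
  | succ M ih => rw [strandParity, ih]; simp [crossAt]

theorem strandParity_false (M : ℕ) : strandParity (fun _ => false) M = false := by
  induction M with
  | zero => rfl
  | succ M ih => rw [strandParity, ih]; rfl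

/-! ### Reduction to the zero function -/

/-- Prolong `N` by strands longer than the radius of `φ`. Without crossing, the function is that of
`N`; with a crossing at `0`, it is zero; and `φ` does not distinguish the two. -/
theorem exists_func_eq_zero {φ : Sentence (netVocabulary m 1)} (hφ : IsFullyAgnostic φ)
    {ℓ : ℕ} (h1 : 1 ≤ ℓ) {N : ReLUNet m 1} (hN : N ∈ layeredNets m ℓ) :
    ∃ ℓ', 1 ≤ ℓ' ∧ ∃ N' ∈ layeredNets m ℓ', N'.func = 0 ∧
      (N.toStructure.Models φ ↔ N'.toStructure.Models φ) := by
  obtain ⟨r, hr⟩ := exists_holdsLocally φ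
  obtain ⟨lay, hle, hinp, hout, hmid, hlay⟩ := id hN
  have hmem := fun ε => strandNet_mem_layeredNets (hlay := hlay) h1 (r + 1) ε hle hinp hout hmid
  refine ⟨ℓ + (r + 1) + 1, by omega, _, hmem (crossAt 0), ?_, ?_⟩
  · funext x i
    rw [Subsingleton.elim i 0, func_strandNet, strandParity_crossAt_zero]
    rfl
  · refine (hφ (ℓ + (r + 1) + 1) (by omega) N ?_
      (N.strandNet lay hlay (r + 1) fun _ => false) ?_ ?_).trans
      (hr N lay hlay (r + 1) 0 Fin.elim0 (by omega) fun i => i.elim0)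
    · exact Set.mem_biUnion (x := ℓ) ⟨h1, by omega⟩ hN
    · exact Set.mem_biUnion (x := ℓ + (r + 1) + 1) ⟨by omega, le_rfl⟩ (hmem fun _ => false)
    · funext x i
      rw [Subsingleton.elim i 0, func_strandNet, strandParity_false, if_pos rfl]

end ReLUNet

theorem IsFullyAgnostic.models_iff {m : ℕ} {φ : FOSum.Sentence (netVocabulary m 1)}
    (hφ : IsFullyAgnostic φ) {N₁ N₂ : ReLUNet m 1} (h₁ : N₁ ∈ ⋃ ℓ ∈ Set.Ici 1, layeredNets m ℓ)
    (h₂ : N₂ ∈ ⋃ ℓ ∈ Set.Ici 1, layeredNets m ℓ) :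
    N₁.toStructure.Models φ ↔ N₂.toStructure.Models φ := by
  simp only [Set.mem_iUnion] at h₁ h₂
  obtain ⟨ℓ₁, hℓ₁, h₁⟩ := h₁
  obtain ⟨ℓ₂, hℓ₂, h₂⟩ := h₂
  obtain ⟨k₁, hk₁, Z₁, hZ₁, hf₁, hφ₁⟩ := ReLUNet.exists_func_eq_zero hφ hℓ₁ h₁
  obtain ⟨k₂, hk₂, Z₂, hZ₂, hf₂, hφ₂⟩ := ReLUNet.exists_func_eq_zero hφ hℓ₂ h₂
  rw [hφ₁, hφ₂]
  exact hφ (max k₁ k₂) (by omega) _ (Set.mem_biUnion (x := k₁) ⟨hk₁, by omega⟩ hZ₁) _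
    (Set.mem_biUnion (x := k₂) ⟨hk₂, by omega⟩ hZ₂) (hf₁.trans hf₂.symm)

end

theorem theorem4 (m : ℕ) (hm : 1 ≤ m) (φ : FOSum.Sentence (netVocabulary m 1))
    (hφ : IsFullyAgnostic φ) :
    (∀ N ∈ ⋃ ℓ ∈ Set.Ici 1, layeredNets m ℓ, N.toStructure.Models φ) ∨
      (∀ N ∈ ⋃ ℓ ∈ Set.Ici 1, layeredNets m ℓ, ¬ N.toStructure.Models φ) := by
  by_contra! h
  obtain ⟨⟨N₁, hN₁, h₁⟩, N₂, hN₂, h₂⟩ := h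
  exact h₁ ((hφ.models_iff hN₁ hN₂).2 h₂)
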